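/- Let $M$ be a finite $n$-dimensional simplicial complex with geometric realization $|M|$, and let $\mathrm{Vol}(M)$ be the number of its $n$-simplices. For a nonzero class $\alpha\in H^1(|M|;\mathbb{Z}/2)$, let $\mathrm{sys}^\alpha(M)$ be the minimal number of edges in a simplicial $1$-cycle $z$ of $M$ with coefficients in $\mathbb{Z}/2$ that is detected by $\alpha$, that is, with $\langle\alpha,[z]\rangle\neq 0$. Let $\mathrm{cut}^\alpha(M)$ be the minimal number of $(n-1)$-simplices in a subcomplex $H$ of $M$ of dimension at most $n-1$ such that the restriction of $\alpha$ to $H^1(|M|\setminus|H|;\mathbb{Z}/2)$ vanishes. Theorem. For every $n$ and every $\varepsilon>0$ there is a constant $c=c(n,\varepsilon)$ such that for every finite $n$-dimensional simplicial complex $M$ and every nonzero $\alpha\in H^1(|M|;\mathbb{Z}/2)$ both minima are attained (the sets of admissible $z$ and $H$ are non-empty), and $$\mathrm{sys}^\alpha(M)\cdot \mathrm{cut}^\alpha(M)\le c\,\mathrm{Vol}(M)^{1+\varepsilon}.$$ -/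

import Mathlib

noncomputable section

namespace SystolicCut

/-! ## Singular cohomology in degree one with coefficients in `ZMod 2` -/

section SingularCohomology

variable {X Y Z : Type*} [TopologicalSpace X] [TopologicalSpace Y] [TopologicalSpace Z]

/-- Singular `k`-simplices of `X`: continuous maps from the standard `k`-simplex to `X`. -/
abbrev SingularSimplex (k : ℕ) (X : Type*) [TopologicalSpace X] : Type _ :=
  C(stdSimplex ℝ (Fin (k + 1)), X)

/-- The inclusion of the face of the standard `(k+1)`-simplex opposite to the vertex `i`. -/
def faceInclusion (k : ℕ) (i : Fin (k + 2)) :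
    C(stdSimplex ℝ (Fin (k + 1)), stdSimplex ℝ (Fin (k + 2))) :=
  ⟨stdSimplex.map i.succAbove, stdSimplex.continuous_map _⟩

/-- Singular `k`-cochains of `X` with coefficients in `ZMod 2`. -/
abbrev SingularCochain (k : ℕ) (X : Type*) [TopologicalSpace X] : Type _ :=
  SingularSimplex k X → ZMod 2

/-- The singular coboundary operator; modulo `2` the usual signs disappear. -/
def coboundary (k : ℕ) (X : Type*) [TopologicalSpace X] :
    SingularCochain k X →ₗ[ZMod 2] SingularCochain (k + 1) X where
  toFun f := fun σ => ∑ i : Fin (k + 2), f (σ.comp (faceInclusion k i))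
  map_add' f g := by
    funext σ
    simp [Finset.sum_add_distrib]
  map_smul' a f := by
    funext σ
    simp [Finset.mul_sum]

/-- Singular `1`-cocycles of `X` with coefficients in `ZMod 2`. -/
abbrev Cocycle1 (X : Type*) [TopologicalSpace X] : Submodule (ZMod 2) (SingularCochain 1 X) :=
  LinearMap.ker (coboundary 1 X)

/-- Singular `1`-coboundaries of `X`, as a submodule of the `1`-cocycles. -/
abbrev Coboundary1 (X : Type*) [TopologicalSpace X] : Submodule (ZMod 2) (Cocycle1 X) :=
  (LinearMap.range (coboundary 0 X)).comap (Cocycle1 X).subtype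

/-- The singular cohomology group `H¹(X; ℤ/2)`. -/
abbrev H1 (X : Type*) [TopologicalSpace X] : Type _ :=
  Cocycle1 X ⧸ Coboundary1 X

/-- Pull-back of singular cochains along a continuous map. -/
def cochainMap (k : ℕ) (f : C(X, Y)) : SingularCochain k Y →ₗ[ZMod 2] SingularCochain k X where
  toFun a := fun σ => a (f.comp σ)
  map_add' _ _ := rfl
  map_smul' _ _ := rfl

theorem coboundary_cochainMap (k : ℕ) (f : C(X, Y)) (a : SingularCochain k Y) :
    coboundary k X (cochainMap k f a) = cochainMap (k + 1) f (coboundary k Y a) := rfl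

/-- Pull-back of singular `1`-cocycles along a continuous map. -/
def cocycleMap (f : C(X, Y)) : Cocycle1 Y →ₗ[ZMod 2] Cocycle1 X :=
  (cochainMap 1 f).restrict fun a ha => by
    rw [LinearMap.mem_ker] at ha ⊢
    rw [coboundary_cochainMap, ha, map_zero]

/-- The homomorphism `H¹(Y; ℤ/2) → H¹(X; ℤ/2)` induced by a continuous map `X → Y`. -/
def H1map (f : C(X, Y)) : H1 Y →ₗ[ZMod 2] H1 X :=
  Submodule.mapQ (Coboundary1 Y) (Coboundary1 X) (cocycleMap f) (by
    rintro a ⟨b, hb⟩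
    refine ⟨cochainMap 0 f b, ?_⟩
    rw [coboundary_cochainMap, hb]
    rfl)

end SingularCohomology

/-! ## Simplicial complexes and their geometric realizations -/

section Complex

variable {ι : Type*}

/-- The `k`-simplices of an abstract simplicial complex: its faces with `k + 1` vertices. -/
abbrev Simplex (K : PreAbstractSimplicialComplex ι) (k : ℕ) : Type _ :=
  {s : Finset ι // s ∈ K.faces ∧ s.card = k + 1}

/-- `K` has dimension `n`: it has an `n`-simplex and no simplex of larger dimension. -/
def HasDimension (K : PreAbstractSimplicialComplex ι) (n : ℕ) : Prop :=
  (∃ s ∈ K.faces, s.card = n + 1) ∧ ∀ s ∈ K.faces, s.card ≤ n + 1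

/-- The volume of an `n`-dimensional complex: the number of its `n`-simplices. -/
def vol (K : PreAbstractSimplicialComplex ι) (n : ℕ) : ℕ :=
  {s | s ∈ K.faces ∧ s.card = n + 1}.ncard

/-- The geometric realization `|K|`, in barycentric coordinates: the points of `ι → ℝ` which are
convex combinations of the vertices of a face. It carries the subspace topology, which for a
finite complex is the usual topology. If `L` is a subcomplex of `K`, then `|L| ⊆ |K|`. -/
def realization (K : PreAbstractSimplicialComplex ι) : Set (ι → ℝ) :=
  {x | (∀ i, 0 ≤ x i) ∧ ∃ s ∈ K.faces, (∀ i, i ∉ s → x i = 0) ∧ ∑ i ∈ s, x i = 1}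

open Classical in
/-- The affine parametrization of an edge of `K` by the standard `1`-simplex, for some
enumeration of the two end points. Replacing the enumeration by the other one does not change
the value of a singular `1`-cocycle modulo `2`. -/
def edgeMap (K : PreAbstractSimplicialComplex ι) (e : Simplex K 1) :
    SingularSimplex 1 (realization K) where
  toFun x := ⟨fun i => if h : i ∈ e.1 then x (e.1.equivFinOfCardEq e.2.2 ⟨i, h⟩) else 0, by
    refine ⟨fun i => ?_, e.1, e.2.1, fun i hi => by simp [hi], ?_⟩
    · by_cases h : i ∈ e.1 <;> simp [h]
    · rw [← Finset.sum_attach, ← stdSimplex.sum_eq_one x,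
        ← Equiv.sum_comp (e.1.equivFinOfCardEq e.2.2)]
      simp⟩
  continuous_toFun := by
    refine Continuous.subtype_mk (continuous_pi fun i => ?_) _
    by_cases h : i ∈ e.1
    · simp only [h, dite_true]
      exact (continuous_apply _).comp continuous_subtype_val
    · simp only [h, dite_false]
      exact continuous_const

/-- A simplicial `1`-cycle of `K` modulo `2`: a finite set of edges such that every vertex lies
on an even number of them. -/
structure SimplicialCycle1 (K : PreAbstractSimplicialComplex ι) where
  edges : Finset (Simplex K 1)
  even_degree : ∀ v : ι, Even {e | e ∈ edges ∧ v ∈ e.1}.ncard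

/-- Evaluation of singular `1`-cocycles of `|K|` on a finite set of edges of `K`. -/
def evalEdges (K : PreAbstractSimplicialComplex ι) (z : Finset (Simplex K 1)) :
    Cocycle1 (realization K) →ₗ[ZMod 2] ZMod 2 where
  toFun a := ∑ e ∈ z, a.1 (edgeMap K e)
  map_add' a b := by simp [Finset.sum_add_distrib]
  map_smul' c a := by simp [Finset.mul_sum]

open Classical in
/-- The `0`-simplex of `|K|` at a vertex of `K`. -/
def vertexMap (K : PreAbstractSimplicialComplex ι) (v : ι) (hv : {v} ∈ K.faces) :
    SingularSimplex 0 (realization K) :=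
  ContinuousMap.const _ ⟨Pi.single v 1, fun i => by
      by_cases h : i = v
      · subst h; simp
      · simp [h], {v}, hv, fun i hi => by
      have h : i ≠ v := by simpa using hi
      simp [h], by simp⟩

theorem vertex_mem (K : PreAbstractSimplicialComplex ι) {s : Finset ι} (hs : s ∈ K.faces) {v : ι}
    (hv : v ∈ s) : {v} ∈ K.faces :=
  (K.isRelLowerSet_faces hs).2 (by simpa using hv) (by simp)

open Classical in
theorem edgeMap_face (K : PreAbstractSimplicialComplex ι) (e : Simplex K 1) (i : Fin 2) :
    (edgeMap K e).comp (faceInclusion 0 i) =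
      vertexMap K ((e.1.equivFinOfCardEq e.2.2).symm (i.succAbove 0)).1
        (vertex_mem K e.2.1 (Subtype.coe_prop _)) := by
  ext x j
  have hx : x 0 = 1 := by simp
  simp only [edgeMap, faceInclusion, vertexMap, ContinuousMap.comp_apply, ContinuousMap.coe_mk,
    ContinuousMap.const_apply, stdSimplex.map_coe, FunOnFinite.linearMap_apply_apply]
  by_cases h : j ∈ e.1
  · by_cases hj : j = ((e.1.equivFinOfCardEq e.2.2).symm (i.succAbove 0)).1
    · have h2 : e.1.equivFinOfCardEq e.2.2 ⟨j, h⟩ = i.succAbove 0 := by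
        rw [← Equiv.eq_symm_apply]; exact Subtype.ext hj
      have h3 : (Finset.univ.filter fun k : Fin (0 + 1) => i.succAbove k = i.succAbove 0) = {0} := by
        ext k; simp
      rw [dif_pos h, h2, h3, Finset.sum_singleton, hx, ← hj, Pi.single_eq_same]
    · have h2 : i.succAbove 0 ≠ e.1.equivFinOfCardEq e.2.2 ⟨j, h⟩ := by
        intro h2
        apply hj
        rw [h2]; simp
      simp [h, h2, hj]
  · have hj : j ≠ ((e.1.equivFinOfCardEq e.2.2).symm (i.succAbove 0)).1 := by
      rintro rfl; exact h (Subtype.coe_prop _)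
    simp [h, hj]

open Classical in
theorem coboundary_edgeMap (K : PreAbstractSimplicialComplex ι)
    (b : SingularCochain 0 (realization K)) (e : Simplex K 1) :
    coboundary 0 (realization K) b (edgeMap K e) =
      ∑ v ∈ e.1, if h : {v} ∈ K.faces then b (vertexMap K v h) else 0 := by
  have h1 : coboundary 0 (realization K) b (edgeMap K e) =
      ∑ i : Fin 2, b ((edgeMap K e).comp (faceInclusion 0 i)) := rfl
  rw [h1, ← Finset.sum_attach e.1,
    ← Finset.univ_eq_attach, ← Equiv.sum_comp (e.1.equivFinOfCardEq e.2.2).symm,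
    Fin.sum_univ_two, Fin.sum_univ_two, edgeMap_face, edgeMap_face, add_comm]
  have h2 : ∀ w : e.1, {w.1} ∈ K.faces := fun w => vertex_mem K e.2.1 w.2
  simp [h2]

theorem evalEdges_coboundary (K : PreAbstractSimplicialComplex ι) (z : SimplicialCycle1 K)
    (b : SingularCochain 0 (realization K)) :
    ∑ e ∈ z.edges, coboundary 0 (realization K) b (edgeMap K e) = 0 := by
  classical
  simp only [coboundary_edgeMap]
  rw [Finset.sum_comm' (t' := z.edges.biUnion fun e => e.1)
    (s' := fun v => z.edges.filter fun e => v ∈ e.1)]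
  · refine Finset.sum_eq_zero fun v _ => ?_
    have h := z.even_degree v
    have h2 : {e | e ∈ z.edges ∧ v ∈ e.1} =
        ((z.edges.filter fun e => v ∈ e.1 : Finset (Simplex K 1)) : Set (Simplex K 1)) := by
      ext e; simp
    rw [h2, Set.ncard_coe_finset] at h
    rw [Finset.sum_const, nsmul_eq_mul, (ZMod.natCast_eq_zero_iff_even).2 h, zero_mul]
  · intro e v
    simp only [Finset.mem_filter, Finset.mem_biUnion]
    tauto

/-- The evaluation (Kronecker pairing) of classes in `H¹(|K|; ℤ/2)` on the singular homology
class of a simplicial `1`-cycle of `K`. -/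
def pairing (K : PreAbstractSimplicialComplex ι) (z : SimplicialCycle1 K) :
    H1 (realization K) →ₗ[ZMod 2] ZMod 2 :=
  (Coboundary1 (realization K)).liftQ (evalEdges K z.edges) (by
    rintro a ⟨b, hb⟩
    rw [LinearMap.mem_ker]
    have h := evalEdges_coboundary K z b
    rw [hb] at h
    exact h)

/-- `sys^α(K)`: the least number of edges in a simplicial `1`-cycle detected by `α`; it is `⊤` if
there is no such cycle. -/
def sys (K : PreAbstractSimplicialComplex ι) (α : H1 (realization K)) : ℕ∞ :=
  ⨅ (z : SimplicialCycle1 K) (_ : pairing K z α ≠ 0), (z.edges.card : ℕ∞)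

/-- The restriction `H¹(|K|; ℤ/2) → H¹(|K| \ |L|; ℤ/2)` to the complement of `|L|`. -/
def restrictCompl (K L : PreAbstractSimplicialComplex ι) :
    H1 (realization K) →ₗ[ZMod 2] H1 ↥(realization K \ realization L) :=
  H1map (ContinuousMap.inclusion Set.sdiff_subset)

/-- `L` is a subcomplex of `K` of dimension at most `n - 1` such that `α` vanishes on
`|K| \ |L|`. -/
def Cuts (K : PreAbstractSimplicialComplex ι) (n : ℕ) (α : H1 (realization K))
    (L : PreAbstractSimplicialComplex ι) : Prop :=
  L ≤ K ∧ (∀ s ∈ L.faces, s.card ≤ n) ∧ restrictCompl K L α = 0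

/-- `cut^α(K)` for an `n`-dimensional complex `K`: the least number of `(n-1)`-simplices (faces
with `n` vertices) in an `(n-1)`-dimensional subcomplex that cuts `α`; it is `⊤` if there is no
such subcomplex. -/
def cut (K : PreAbstractSimplicialComplex ι) (n : ℕ) (α : H1 (realization K)) : ℕ∞ :=
  ⨅ (L : PreAbstractSimplicialComplex ι) (_ : Cuts K n α L), {s | s ∈ L.faces ∧ s.card = n}.encard

end Complex

end SystolicCut

end

/-! Fix a cocycle representing `α` and write `V` for the volume. A closed chain with fewer edges
than the systole has value zero. Hence, on a ball of radius `R` with `2R + 1 < sys`, the value of a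
short chain from the centre is a well-defined potential: the cocycle on an edge is the sum of the
potentials of its end points (`exists_potential_chainBall`).

Suppose the `n`-simplices are grouped into clusters, each inside such a ball. Removing the
`(n-2)`-skeleton and the `(n-1)`-simplices shared by different clusters leaves open simplices whose
potentials agree wherever they are adjacent, so `α` dies on the complement (`cut_le_card_sepFaces`,
via `H1map_eq_zero_of_potential`).

Few separating simplices are needed, by ball growing (`exists_centers`). A ball cannot gain a factor
`1 + δ` at each of `R` steps once `(1 + δ)^R > V`, so some ball has a boundary layer of at most `δ`
times its own size. Cutting it off and iterating costs at most `(n + 1) δ V` in total. With `R`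
proportional to the systole and `δ` of order `V^ε / sys`, the product of systole and cut is
`O(V^(1+ε))`.

The same chain argument without a length bound shows that a class detected by no cycle is zero
(`sys_ne_top`). -/

noncomputable section

namespace SystolicCut

/-! ### Singular 1-cocycles: additivity, subdivision and local exactness -/

section Topology

variable {X Y E : Type*} [TopologicalSpace X] [TopologicalSpace Y]
  [AddCommGroup E] [Module ℝ E] [TopologicalSpace E] [ContinuousAdd E] [ContinuousSMul ℝ E]

/-- The affine `1`-simplex from `p` to `q` in a convex set. -/
def line {C : Set E} (hC : Convex ℝ C) (p q : C) : C(stdSimplex ℝ (Fin 2), C) where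
  toFun y := ⟨y 0 • p.1 + y 1 • q.1,
    hC p.2 q.2 (y.2.1 0) (y.2.1 1) (stdSimplex.add_eq_one y)⟩
  continuous_toFun := by
    refine Continuous.subtype_mk ?_ _
    have h : ∀ i, Continuous fun y : stdSimplex ℝ (Fin 2) => y i := fun i =>
      (continuous_apply i).comp continuous_subtype_val
    exact ((h 0).smul continuous_const).add ((h 1).smul continuous_const)

/-- The affine `2`-simplex with vertices `p`, `q`, `r` in a convex set. -/
def triangle {C : Set E} (hC : Convex ℝ C) (p q r : C) : C(stdSimplex ℝ (Fin 3), C) where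
  toFun y := ⟨y 0 • p.1 + y 1 • q.1 + y 2 • r.1, by
    have h := hC.sum_mem (t := Finset.univ) (w := fun i => y i) (z := ![p.1, q.1, r.1])
      (fun i _ => y.2.1 i) (stdSimplex.sum_eq_one y)
      (fun i _ => by fin_cases i <;> simp)
    simpa [Fin.sum_univ_three] using h⟩
  continuous_toFun := by
    refine Continuous.subtype_mk ?_ _
    have h : ∀ i, Continuous fun y : stdSimplex ℝ (Fin 3) => y i := fun i =>
      (continuous_apply i).comp continuous_subtype_val
    exact (((h 0).smul continuous_const).add ((h 1).smul continuous_const)).add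
      ((h 2).smul continuous_const)

theorem faceInclusion_apply_succAbove (k : ℕ) (i : Fin (k + 2)) (y : stdSimplex ℝ (Fin (k + 1)))
    (j : Fin (k + 1)) : faceInclusion k i y (i.succAbove j) = y j := by
  classical
  have h : (Finset.univ.filter fun l : Fin (k + 1) => i.succAbove l = i.succAbove j) = {j} := by
    ext l; simp
  simp only [faceInclusion, ContinuousMap.coe_mk, stdSimplex.map_coe,
    FunOnFinite.linearMap_apply_apply]
  rw [h, Finset.sum_singleton]

theorem faceInclusion_apply_self (k : ℕ) (i : Fin (k + 2)) (y : stdSimplex ℝ (Fin (k + 1))) :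
    faceInclusion k i y i = 0 := by
  classical
  simp [faceInclusion, FunOnFinite.linearMap_apply_apply]

theorem triangle_face_zero {C : Set E} (hC : Convex ℝ C) (p q r : C) :
    (triangle hC p q r).comp (faceInclusion 1 0) = line hC q r := by
  ext1 y
  have h0 : faceInclusion 1 0 y 0 = 0 := faceInclusion_apply_self 1 0 y
  have h1 : faceInclusion 1 0 y 1 = y 0 := faceInclusion_apply_succAbove 1 0 y 0
  have h2 : faceInclusion 1 0 y 2 = y 1 := faceInclusion_apply_succAbove 1 0 y 1
  apply Subtype.ext
  simp [triangle, line, h0, h1, h2]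

theorem triangle_face_one {C : Set E} (hC : Convex ℝ C) (p q r : C) :
    (triangle hC p q r).comp (faceInclusion 1 1) = line hC p r := by
  ext1 y
  have h0 : faceInclusion 1 1 y 1 = 0 := faceInclusion_apply_self 1 1 y
  have h1 : faceInclusion 1 1 y 0 = y 0 := faceInclusion_apply_succAbove 1 1 y 0
  have h2 : faceInclusion 1 1 y 2 = y 1 := faceInclusion_apply_succAbove 1 1 y 1
  apply Subtype.ext
  simp [triangle, line, h0, h1, h2]

theorem triangle_face_two {C : Set E} (hC : Convex ℝ C) (p q r : C) :
    (triangle hC p q r).comp (faceInclusion 1 2) = line hC p q := by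
  ext1 y
  have h0 : faceInclusion 1 2 y 2 = 0 := faceInclusion_apply_self 1 2 y
  have h1 : faceInclusion 1 2 y 0 = y 0 := faceInclusion_apply_succAbove 1 2 y 0
  have h2 : faceInclusion 1 2 y 1 = y 1 := faceInclusion_apply_succAbove 1 2 y 1
  apply Subtype.ext
  simp [triangle, line, h0, h1, h2]

/-- This is the cocycle identity on the image of an affine triangle. The convex domain is arbitrary,
so it serves both for subdividing an interval and for cutting a prism into triangles. -/
theorem cocycle_line_add (a : Cocycle1 X) {C : Set E} (hC : Convex ℝ C) (Q : C(C, X))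
    (p q r : C) :
    a.1 (Q.comp (line hC p q)) + a.1 (Q.comp (line hC q r)) = a.1 (Q.comp (line hC p r)) := by
  have h : coboundary 1 X a.1 (Q.comp (triangle hC p q r)) = 0 := by
    rw [LinearMap.mem_ker.1 a.2]; rfl
  change ∑ i : Fin 3, a.1 ((Q.comp (triangle hC p q r)).comp (faceInclusion 1 i)) = 0 at h
  simp only [Fin.sum_univ_three, ContinuousMap.comp_assoc, triangle_face_zero,
    triangle_face_one, triangle_face_two] at h
  linear_combination h - CharTwo.add_self_eq_zero (a.1 (Q.comp (line hC p r)))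

theorem cocycle_const (a : Cocycle1 X) (x : X) :
    a.1 (ContinuousMap.const _ x) = 0 := by
  have h := cocycle_line_add a (convex_univ (E := ℝ) (𝕜 := ℝ))
    (ContinuousMap.const _ x) ⟨0, trivial⟩ ⟨0, trivial⟩ ⟨0, trivial⟩
  simpa [ContinuousMap.const_comp] using h

/-- The standard parametrization of the `1`-simplex. -/
def edgeParam : C(Set.Icc (0 : ℝ) 1, stdSimplex ℝ (Fin 2)) where
  toFun t := ⟨![1 - t.1, t.1], by
    refine ⟨fun i => ?_, by simp⟩
    fin_cases i
    · simpa using t.2.2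
    · simpa using t.2.1⟩
  continuous_toFun := by
    refine Continuous.subtype_mk (continuous_pi fun i => ?_) _
    fin_cases i
    · exact continuous_const.sub continuous_subtype_val
    · exact continuous_subtype_val

theorem edgeParam_comp_line (σ : SingularSimplex 1 X) :
    (σ.comp edgeParam).comp (line (convex_Icc (0 : ℝ) 1) 0 1) = σ := by
  ext1 y
  simp only [ContinuousMap.comp_apply]
  congr 1
  ext i
  have h := stdSimplex.add_eq_one y
  have h' : edgeParam (line (convex_Icc (0 : ℝ) 1) 0 1 y) i = (![1 - y 1, y 1] : Fin 2 → ℝ) i := by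
    simp [edgeParam, line]
    rfl
  rw [h']
  fin_cases i
  · simp; linarith
  · simp

/-- A `1`-cocycle which is locally the coboundary of `B` is the coboundary of `B`. -/
theorem cocycle_eq_of_locally (a : Cocycle1 X) (B : X → ZMod 2)
    (hB : ∀ x, ∃ U : Set X, IsOpen U ∧ x ∈ U ∧ ∀ σ : SingularSimplex 1 X, (∀ y, σ y ∈ U) →
      a.1 σ = B (σ (stdSimplex.vertex 0)) + B (σ (stdSimplex.vertex 1)))
    (σ : SingularSimplex 1 X) :
    a.1 σ = B (σ (stdSimplex.vertex 0)) + B (σ (stdSimplex.vertex 1)) := by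
  choose U hU hxU hUB using hB
  set g : C(Set.Icc (0 : ℝ) 1, X) := σ.comp edgeParam with hg
  -- Lebesgue subdivision: each piece of the path lies in one set of the cover, and `t` reaches `1`
  -- at step `N`.
  obtain ⟨t, ht0, htm, ⟨N, hN⟩, ht⟩ := exists_monotone_Icc_subset_open_cover_unitInterval
    (c := fun x => g ⁻¹' U x) (fun x => (hU x).preimage g.continuous)
    (fun s _ => Set.mem_iUnion.2 ⟨g s, hxU _⟩)
  -- The contributions of `B` at interior subdivision points occur twice and cancel modulo `2`.
  have key : ∀ m, a.1 (g.comp (line (convex_Icc (0 : ℝ) 1) (t 0) (t m))) =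
      B (g (t 0)) + B (g (t m)) := by
    intro m
    induction m with
    | zero =>
      have : g.comp (line (convex_Icc (0 : ℝ) 1) (t 0) (t 0)) =
          ContinuousMap.const _ (g (t 0)) := by
        ext1 y
        simp only [ContinuousMap.comp_apply, ContinuousMap.const_apply]
        congr 1
        apply Subtype.ext
        simp only [line, ContinuousMap.coe_mk]
        rw [← add_smul, stdSimplex.add_eq_one, one_smul]
      rw [this, cocycle_const, CharTwo.add_self_eq_zero]
    | succ m ih =>
      rw [← cocycle_line_add a (convex_Icc (0 : ℝ) 1) g (t 0) (t m) (t (m + 1)), ih]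
      obtain ⟨x, hx⟩ := ht m
      have h := hUB x (g.comp (line (convex_Icc (0 : ℝ) 1) (t m) (t (m + 1)))) (by
        intro y
        apply hx
        have h1 := (convex_Icc (t m).1 (t (m + 1)).1) (Set.left_mem_Icc.2 (htm (Nat.le_succ m)))
          (Set.right_mem_Icc.2 (htm (Nat.le_succ m))) (y.2.1 0) (y.2.1 1)
          (stdSimplex.add_eq_one y)
        exact h1)
      rw [h]
      have e0 : line (convex_Icc (0 : ℝ) 1) (t m) (t (m + 1)) (stdSimplex.vertex 0) = t m := by
        apply Subtype.ext; simp [line]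
      have e1 : line (convex_Icc (0 : ℝ) 1) (t m) (t (m + 1)) (stdSimplex.vertex 1) =
          t (m + 1) := by
        apply Subtype.ext; simp [line]
      rw [ContinuousMap.comp_apply g, ContinuousMap.comp_apply g, e0, e1]
      linear_combination CharTwo.add_self_eq_zero (B (g (t m)))
  have h := key N
  rw [ht0, hN N le_rfl, hg, edgeParam_comp_line] at h
  have e0 : edgeParam 0 = stdSimplex.vertex 0 := by
    apply Subtype.ext; funext i; fin_cases i <;> simp [edgeParam]
  have e1 : edgeParam 1 = stdSimplex.vertex 1 := by
    apply Subtype.ext; funext i; fin_cases i <;> simp [edgeParam]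
  rwa [ContinuousMap.comp_apply, ContinuousMap.comp_apply, e0, e1] at h

theorem faceInclusion_zero_apply (i : Fin 2) (y : stdSimplex ℝ (Fin 1)) :
    faceInclusion 0 i y = stdSimplex.vertex (i.succAbove 0) := by
  obtain rfl : y = stdSimplex.vertex 0 := Subsingleton.elim _ _
  exact stdSimplex.map_vertex _ _

theorem mk_eq_zero_of_locally (a : Cocycle1 X) (B : X → ZMod 2)
    (hB : ∀ x, ∃ U : Set X, IsOpen U ∧ x ∈ U ∧ ∀ σ : SingularSimplex 1 X, (∀ y, σ y ∈ U) →
      a.1 σ = B (σ (stdSimplex.vertex 0)) + B (σ (stdSimplex.vertex 1))) :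
    (Submodule.Quotient.mk a : H1 X) = 0 := by
  rw [Submodule.Quotient.mk_eq_zero]
  refine ⟨fun τ => B (τ default), ?_⟩
  funext σ
  change ∑ i : Fin 2, B (σ (faceInclusion 0 i default)) = a.1 σ
  rw [cocycle_eq_of_locally a B hB σ, Fin.sum_univ_two, faceInclusion_zero_apply,
    faceInclusion_zero_apply, add_comm]
  rfl

end Topology

/-! ### Straight segments and coning -/

section Segments

variable {E : Type*} [AddCommGroup E] [Module ℝ E] [TopologicalSpace E] [ContinuousAdd E]
  [ContinuousSMul ℝ E] {X : Set E}

/-- The straight singular `1`-simplex from `p` to `q`. -/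
def straight {p q : E} (h : segment ℝ p q ⊆ X) : SingularSimplex 1 X where
  toFun y := ⟨y 0 • p + y 1 • q,
    h ⟨y 0, y 1, y.2.1 0, y.2.1 1, stdSimplex.add_eq_one y, rfl⟩⟩
  continuous_toFun := by
    refine Continuous.subtype_mk ?_ _
    have h : ∀ i, Continuous fun y : stdSimplex ℝ (Fin 2) => y i := fun i =>
      (continuous_apply i).comp continuous_subtype_val
    exact ((h 0).smul continuous_const).add ((h 1).smul continuous_const)

open Classical in
/-- The value of a cocycle on the straight `1`-simplex from `p` to `q`; it is `0` if the segment
is not contained in `X`. -/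
def segVal (a : Cocycle1 X) (p q : E) : ZMod 2 :=
  if h : segment ℝ p q ⊆ X then a.1 (straight h) else 0

theorem segVal_of_subset (a : Cocycle1 X) {p q : E} (h : segment ℝ p q ⊆ X) :
    segVal a p q = a.1 (straight h) := dif_pos h

theorem segVal_self (a : Cocycle1 X) {p : E} (hp : p ∈ X) : segVal a p p = 0 := by
  have h : segment ℝ p p ⊆ X := by simpa using hp
  rw [segVal_of_subset a h]
  convert cocycle_const a (⟨p, hp⟩ : X)
  ext1 y
  apply Subtype.ext
  simp only [straight, ContinuousMap.coe_mk, ContinuousMap.const_apply]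
  rw [← add_smul, stdSimplex.add_eq_one, one_smul]

/-- Coning off a singular `1`-simplex from a point `p`. -/
theorem cocycle_cone (a : Cocycle1 X) (σ : SingularSimplex 1 X) (p : E)
    (h : ∀ y, segment ℝ p (σ y : E) ⊆ X) :
    a.1 σ = segVal a p (σ (stdSimplex.vertex 0)) + segVal a p (σ (stdSimplex.vertex 1)) := by
  -- The cone is parametrized by a square: `Q` collapses the side `0` to `p` and restricts to `σ` on
  -- the side `1`.
  set C : Set (ℝ × (Fin 2 → ℝ)) := Set.Icc (0 : ℝ) 1 ×ˢ stdSimplex ℝ (Fin 2) with hCdef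
  have hC : Convex ℝ C := (convex_Icc 0 1).prod (convex_stdSimplex ℝ (Fin 2))
  have hcont : Continuous fun z : C => σ ⟨z.1.2, z.2.2⟩ :=
    σ.continuous.comp (Continuous.subtype_mk (continuous_snd.comp continuous_subtype_val) _)
  let Q : C(C, X) :=
    { toFun := fun z => ⟨(1 - z.1.1) • p + z.1.1 • (σ ⟨z.1.2, z.2.2⟩ : E),
        h ⟨z.1.2, z.2.2⟩ ⟨1 - z.1.1, z.1.1, sub_nonneg.2 z.2.1.2, z.2.1.1, by ring, rfl⟩⟩
      continuous_toFun := by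
        refine Continuous.subtype_mk ?_ _
        have h1 : Continuous fun z : C => z.1.1 := continuous_fst.comp continuous_subtype_val
        exact ((continuous_const.sub h1).smul continuous_const).add
          (h1.smul (continuous_subtype_val.comp hcont)) }
  let c (s : ℝ) (hs : s ∈ Set.Icc (0 : ℝ) 1) (i : Fin 2) : C :=
    ⟨(s, (stdSimplex.vertex (S := ℝ) i).1), hs, (stdSimplex.vertex (S := ℝ) i).2⟩
  have m0 : (0 : ℝ) ∈ Set.Icc (0 : ℝ) 1 := by simp
  have m1 : (1 : ℝ) ∈ Set.Icc (0 : ℝ) 1 := by simp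
  have hp : p ∈ X := h (stdSimplex.vertex 0) (left_mem_segment ℝ _ _)
  have hbase : ∀ y : stdSimplex ℝ (Fin 2), y 0 • (stdSimplex.vertex (S := ℝ) (0 : Fin 2)).1 +
      y 1 • (stdSimplex.vertex (S := ℝ) (1 : Fin 2)).1 = y.1 := by
    intro y
    funext i
    fin_cases i <;> simp <;> rfl
  have hvert : ∀ i, ∀ y : stdSimplex ℝ (Fin 2), y 0 • (stdSimplex.vertex (S := ℝ) (i : Fin 2)).1 +
      y 1 • (stdSimplex.vertex (S := ℝ) (i : Fin 2)).1 =
      (stdSimplex.vertex (S := ℝ) (i : Fin 2)).1 := by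
    intro i y
    rw [← add_smul, stdSimplex.add_eq_one, one_smul]
  have hσ : ∀ y y' : stdSimplex ℝ (Fin 2), y.1 = y'.1 → (σ y : E) = σ y' := by
    intro y y' h; rw [Subtype.ext h]
  have e1 : Q.comp (line hC (c 1 m1 0) (c 1 m1 1)) = σ := by
    ext1 y
    apply Subtype.ext
    simp only [Q, line, c, ContinuousMap.comp_apply, ContinuousMap.coe_mk, Prod.fst_add,
      Prod.snd_add, Prod.smul_fst, Prod.smul_snd, smul_eq_mul, mul_one,
      stdSimplex.add_eq_one, sub_self, zero_smul, zero_add, one_smul]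
    exact hσ _ _ (hbase y)
  have e2 : Q.comp (line hC (c 0 m0 0) (c 0 m0 1)) = ContinuousMap.const _ ⟨p, hp⟩ := by
    ext1 y
    apply Subtype.ext
    simp [Q, line, c]
  have e3 : ∀ i, Q.comp (line hC (c 0 m0 i) (c 1 m1 i)) = straight (h (stdSimplex.vertex i)) := by
    intro i
    ext1 y
    apply Subtype.ext
    have hy : 1 - y 1 = y 0 := by linarith [stdSimplex.add_eq_one y]
    simp only [Q, line, c, straight, ContinuousMap.comp_apply, ContinuousMap.coe_mk, Prod.fst_add,
      Prod.snd_add, Prod.smul_fst, Prod.smul_snd, smul_eq_mul, mul_one, mul_zero, zero_add, hy]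
    congr 2
    exact hσ _ _ (hvert i y)
  -- The two triangles of the square share a diagonal, whose value is eliminated; the collapsed side
  -- contributes zero.
  have t1 := cocycle_line_add a hC Q (c 0 m0 0) (c 1 m1 0) (c 1 m1 1)
  have t2 := cocycle_line_add a hC Q (c 0 m0 0) (c 0 m0 1) (c 1 m1 1)
  rw [e1, e3] at t1
  rw [e2, e3, cocycle_const] at t2
  rw [segVal_of_subset a (h _), segVal_of_subset a (h _)]
  linear_combination t1 - t2 - CharTwo.add_self_eq_zero (a.1 (straight (h (stdSimplex.vertex 0))))

theorem segVal_triangle (a : Cocycle1 X) {p q r : E} {C : Set E} (hC : Convex ℝ C) (hCX : C ⊆ X)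
    (hp : p ∈ C) (hq : q ∈ C) (hr : r ∈ C) :
    segVal a p q + segVal a p r = segVal a q r := by
  have hqr := (hC.segment_subset hq hr).trans hCX
  have h := cocycle_cone a (straight hqr) p (fun y =>
    (hC.segment_subset hp (hC.segment_subset hq hr
      ⟨y 0, y 1, y.2.1 0, y.2.1 1, stdSimplex.add_eq_one y, rfl⟩)).trans hCX)
  rw [segVal_of_subset a hqr, h]
  simp [straight]

end Segments

/-! ### From potentials on vertices to vanishing of a cohomology class -/

section Realization

variable {ι : Type*} {Y : Type*} [TopologicalSpace Y] {M : PreAbstractSimplicialComplex ι}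

/-- The closed simplex spanned by `s`, in barycentric coordinates. -/
def closedCell (s : Finset ι) : Set (ι → ℝ) :=
  {x | (∀ i, 0 ≤ x i) ∧ (∀ i, i ∉ s → x i = 0) ∧ ∑ i ∈ s, x i = 1}

theorem convex_closedCell (s : Finset ι) : Convex ℝ (closedCell s) := by
  rintro x ⟨hx0, hxs, hx1⟩ y ⟨hy0, hys, hy1⟩ p q hp hq hpq
  refine ⟨fun i => ?_, fun i hi => ?_, ?_⟩
  · exact add_nonneg (mul_nonneg hp (hx0 i)) (mul_nonneg hq (hy0 i))
  · simp [hxs i hi, hys i hi]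
  · simp [Finset.sum_add_distrib, ← Finset.mul_sum, hx1, hy1, hpq]

theorem closedCell_subset {s : Finset ι} (hs : s ∈ M.faces) : closedCell s ⊆ realization M :=
  fun _ hx => ⟨hx.1, s, hs, hx.2⟩

open Classical in
/-- The vertex `v` as a point of the realization. -/
def vert (v : ι) : ι → ℝ := Pi.single v 1

theorem vert_mem_closedCell {s : Finset ι} {v : ι} (hv : v ∈ s) : vert v ∈ closedCell s := by
  classical
  refine ⟨fun i => ?_, fun i hi => ?_, ?_⟩
  · by_cases h : i = v
    · subst h; simp [vert]
    · simp [vert, h]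
  · have h : i ≠ v := by rintro rfl; exact hi hv
    simp [vert, h]
  · simp [vert, hv]

open Classical in
/-- The set of vertices with nonzero barycentric coordinate. -/
def carrier (x : ι → ℝ) : Finset ι :=
  if h : (Function.support x).Finite then h.toFinset else ∅

theorem finite_support {x : ι → ℝ} (hx : x ∈ realization M) : (Function.support x).Finite := by
  obtain ⟨_, s, -, hs, -⟩ := hx
  exact s.finite_toSet.subset fun i hi => by_contra fun h => hi (hs i h)

theorem mem_carrier {x : ι → ℝ} (hx : x ∈ realization M) {i : ι} : i ∈ carrier x ↔ x i ≠ 0 := by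
  simp [carrier, finite_support hx]

theorem mem_closedCell_carrier {x : ι → ℝ} (hx : x ∈ realization M) :
    x ∈ closedCell (carrier x) := by
  refine ⟨hx.1, fun i hi => by simpa using mt (mem_carrier hx).2 hi, ?_⟩
  obtain ⟨-, s, -, hs, h1⟩ := id hx
  rw [← h1]
  refine Finset.sum_subset (fun i hi => ?_) (fun i _ hi => by simpa using mt (mem_carrier hx).2 hi)
  exact by_contra fun h => (mem_carrier hx).1 hi (hs i h)

theorem carrier_nonempty {x : ι → ℝ} (hx : x ∈ realization M) : (carrier x).Nonempty := by
  rw [Finset.nonempty_iff_ne_empty]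
  intro h
  have := (mem_closedCell_carrier hx).2.2
  simp [h] at this

theorem carrier_mem_faces {x : ι → ℝ} (hx : x ∈ realization M) : carrier x ∈ M.faces := by
  obtain ⟨-, s, hsM, hs, -⟩ := id hx
  exact (M.isRelLowerSet_faces hsM).2
    (fun i hi => by_contra fun h => (mem_carrier hx).1 hi (hs i h)) (carrier_nonempty hx)

/-- A class of `|M|` vanishes on `Y` if it has compatible potentials on the simplices carrying the
points of `Y`. -/
theorem H1map_eq_zero_of_potential (f : C(Y, realization M)) (a : Cocycle1 (realization M))
    (F : Set (Finset ι)) (hF : F ⊆ M.faces) (hf : ∀ y, carrier (f y : ι → ℝ) ∈ F)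
    (β : Finset ι → ι → ZMod 2)
    (hβ : ∀ s ∈ F, ∀ v ∈ s, ∀ w ∈ s, segVal a (vert v) (vert w) = β s v + β s w)
    (hβ' : ∀ s ∈ F, ∀ t ∈ F, s ⊆ t → ∀ v ∈ s, β s v = β t v) :
    H1map f (Submodule.Quotient.mk a) = 0 := by
  have hne : ∀ y, ∃ v, v ∈ carrier (f y : ι → ℝ) := fun y => carrier_nonempty (f y).2
  choose c hc using hne
  -- The primitive at `y` is the potential at a vertex of the carrier plus the cocycle on the
  -- segment from that vertex to `y`. The vertex `c y` may jump with `y`; `key` shows that the value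
  -- does not depend on it.
  refine mk_eq_zero_of_locally (cocycleMap f a)
    (fun y => segVal a (vert (c y)) (f y) + β (carrier (f y : ι → ℝ)) (c y)) fun y => ?_
  obtain ⟨v, hv⟩ : ∃ v, v ∈ carrier (f y : ι → ℝ) := ⟨c y, hc y⟩
  set s := carrier (f y : ι → ℝ) with hs
  have hcoord : ∀ i : ι, Continuous fun z => (f z : ι → ℝ) i := fun i =>
    (continuous_apply i).comp (continuous_subtype_val.comp f.continuous)
  -- This is the preimage of the open star of `s`: every carrier there contains `s`, so the single
  -- vertex `v` can serve as cone point.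
  have hU : IsOpen {z | ∀ i ∈ s, (f z : ι → ℝ) i ≠ 0} := by
    simp only [Set.ofPred_forall]
    exact isOpen_biInter_finset fun i _ => isOpen_ne_fun (hcoord i) continuous_const
  refine ⟨_, hU, fun i hi => (mem_carrier (f y).2).1 hi, fun σ hσ => ?_⟩
  have key : ∀ z ∈ {z | ∀ i ∈ s, (f z : ι → ℝ) i ≠ 0},
      segVal a (vert (c z)) (f z) + β (carrier (f z : ι → ℝ)) (c z) =
        segVal a (vert v) (f z) + β s v := by
    intro z hz
    have hst : s ⊆ carrier (f z : ι → ℝ) := fun i hi => (mem_carrier (f z).2).2 (hz i hi)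
    have h1 := segVal_triangle a (convex_closedCell _) (closedCell_subset (hF (hf z)))
      (vert_mem_closedCell (hst hv)) (vert_mem_closedCell (hc z)) (mem_closedCell_carrier (f z).2)
    rw [← h1, hβ _ (hf z) v (hst hv) (c z) (hc z), hβ' s (hf y) _ (hf z) hst v hv]
    linear_combination CharTwo.add_self_eq_zero (β (carrier (f z : ι → ℝ)) (c z))
  rw [key _ (hσ _), key _ (hσ _)]
  have h2 := cocycle_cone a (f.comp σ) (vert v) fun z => by
    have hvz : v ∈ carrier (f (σ z) : ι → ℝ) := (mem_carrier (f _).2).2 (hσ z v hv)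
    exact ((convex_closedCell _).segment_subset (vert_mem_closedCell hvz)
      (mem_closedCell_carrier (f _).2)).trans (closedCell_subset (hF (hf _)))
  change a.1 (f.comp σ) = _
  rw [h2]
  simp only [ContinuousMap.comp_apply]
  linear_combination -CharTwo.add_self_eq_zero (β s v)

theorem edgeMap_vertex (e : Simplex M 1) (j : Fin 2) :
    (edgeMap M e (stdSimplex.vertex j) : ι → ℝ) =
      vert ((e.1.equivFinOfCardEq e.2.2).symm j).1 := by
  classical
  funext i
  have h0 : (edgeMap M e (stdSimplex.vertex j) : ι → ℝ) i = if h : i ∈ e.1 then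
    (stdSimplex.vertex (S := ℝ) j) (e.1.equivFinOfCardEq e.2.2 ⟨i, h⟩) else 0 := rfl
  rw [h0, vert, Pi.single_apply]
  by_cases h : i ∈ e.1
  · have h1 : i = ((e.1.equivFinOfCardEq e.2.2).symm j).1 ↔
        e.1.equivFinOfCardEq e.2.2 ⟨i, h⟩ = j := by
      rw [← Equiv.eq_symm_apply, Subtype.ext_iff]
    simp only [h, dite_true, h1, stdSimplex.vertex_coe, Pi.single_apply]
  · have h1 : i ≠ ((e.1.equivFinOfCardEq e.2.2).symm j).1 := by
      rintro rfl; exact h (Subtype.coe_prop _)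
    simp [h, h1]

/-- Coning the edge from its own end point `v` makes one of the two terms degenerate, whichever
enumeration `edgeMap` uses. -/
theorem cocycle_edgeMap (a : Cocycle1 (realization M)) (e : Simplex M 1) {v w : ι} (hvw : v ≠ w)
    (hv : v ∈ e.1) (hw : w ∈ e.1) :
    a.1 (edgeMap M e) = segVal a (vert v) (vert w) := by
  have hX : vert v ∈ realization M := closedCell_subset e.2.1 (vert_mem_closedCell hv)
  have h := cocycle_cone a (edgeMap M e) (vert v) fun y => by
    refine ((convex_closedCell e.1).segment_subset (vert_mem_closedCell hv) ?_).trans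
      (closedCell_subset e.2.1)
    refine ⟨(edgeMap M e y).2.1, fun i hi => ?_, ?_⟩
    · simp [edgeMap, hi]
    · rw [← Finset.sum_attach, ← stdSimplex.sum_eq_one y,
        ← Equiv.sum_comp (e.1.equivFinOfCardEq e.2.2)]
      simp [edgeMap]
  rw [h, edgeMap_vertex, edgeMap_vertex]
  set q := e.1.equivFinOfCardEq e.2.2
  have hqv : (q.symm (q ⟨v, hv⟩)).1 = v := by simp
  have hqw : (q.symm (q ⟨w, hw⟩)).1 = w := by simp
  have hne : q ⟨v, hv⟩ ≠ q ⟨w, hw⟩ := fun h => hvw (by simpa using q.injective h)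
  generalize q ⟨v, hv⟩ = i at *
  generalize q ⟨w, hw⟩ = j at *
  fin_cases i <;> fin_cases j <;> simp at hne hqv hqw ⊢ <;>
    rw [hqv, hqw, segVal_self a hX] <;> simp

end Realization

/-! ### Edge chains, short cycles and potentials on balls -/

section Chains

variable {ι : Type*} {M : PreAbstractSimplicialComplex ι}

open Classical in
/-- The indicator function modulo `2` of a vertex. -/
def ind (v : ι) : ι → ZMod 2 := Pi.single v 1

open Classical in
/-- The boundary modulo `2` of a list of edges. -/
def bd (l : List (Simplex M 1)) : ι → ZMod 2 :=
  fun x => (l.map fun e => if x ∈ e.1 then (1 : ZMod 2) else 0).sum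

/-- The value of a cocycle on a list of edges. -/
def chainVal (a : Cocycle1 (realization M)) (l : List (Simplex M 1)) : ZMod 2 :=
  (l.map fun e => a.1 (edgeMap M e)).sum

theorem bd_append (l l' : List (Simplex M 1)) : bd (l ++ l') = bd l + bd l' := by
  funext x; simp [bd]

theorem chainVal_append (a : Cocycle1 (realization M)) (l l' : List (Simplex M 1)) :
    chainVal a (l ++ l') = chainVal a l + chainVal a l' := by
  simp [chainVal]

theorem bd_singleton (e : Simplex M 1) {v w : ι} (hvw : v ≠ w) (hv : v ∈ e.1) (hw : w ∈ e.1) :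
    bd [e] = ind v + ind w := by
  classical
  have he : e.1 = {v, w} := by
    symm
    apply Finset.eq_of_subset_of_card_le
    · intro x hx
      rcases Finset.mem_insert.1 hx with rfl | hx
      · exact hv
      · rwa [Finset.mem_singleton.1 hx]
    · rw [e.2.2, Finset.card_pair hvw]
  funext x
  by_cases h1 : x = v
  · subst h1; simp [bd, ind, he, hvw]
  · by_cases h2 : x = w
    · subst h2; simp [bd, ind, he, h1]
    · simp [bd, ind, he, h1, h2]

theorem ind_add_self (v : ι) : ind v + ind v = 0 := by
  funext x; exact CharTwo.add_self_eq_zero _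

/-- The elements that occur an odd number of times in a list carry its sum modulo `2`. -/
theorem exists_finset_sum_eq {α : Type*} (l : List α) :
    ∃ S : Finset α, S.card ≤ l.length ∧ ∀ g : α → ZMod 2, ∑ x ∈ S, g x = (l.map g).sum := by
  classical
  refine ⟨l.toFinset.filter fun x => Odd (l.count x),
    (Finset.card_filter_le _ _).trans (List.toFinset_card_le l), fun g => ?_⟩
  rw [Finset.sum_list_map_count, Finset.sum_filter]
  refine Finset.sum_congr rfl fun x _ => ?_
  split_ifs with h
  · rw [nsmul_eq_mul, (ZMod.natCast_eq_one_iff_odd).2 h, one_mul]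
  · rw [nsmul_eq_mul, (ZMod.natCast_eq_zero_iff_even).2 (Nat.not_odd_iff_even.1 h), zero_mul]

/-- The edges of odd multiplicity form a simplicial cycle with the same value and no more edges; a
nonzero value would contradict the minimality of the systole. -/
theorem chainVal_eq_zero (a : Cocycle1 (realization M)) (l : List (Simplex M 1)) (hl : bd l = 0)
    (hs : (l.length : ℕ∞) < sys M (Submodule.Quotient.mk a)) : chainVal a l = 0 := by
  classical
  by_contra h
  obtain ⟨S, h2, hS⟩ := exists_finset_sum_eq l
  let z : SimplicialCycle1 M := ⟨S, fun v => by
    have h2 : {e | e ∈ S ∧ v ∈ e.1} =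
        ((S.filter fun e => v ∈ e.1 : Finset (Simplex M 1)) : Set (Simplex M 1)) := by
      ext e; simp
    rw [h2, Set.ncard_coe_finset, ← ZMod.natCast_eq_zero_iff_even, Finset.natCast_card_filter, hS]
    exact congrFun hl v⟩
  have hz : pairing M z (Submodule.Quotient.mk a) ≠ 0 := by
    change ∑ e ∈ S, a.1 (edgeMap M e) ≠ 0
    rw [hS]
    exact h
  have h1 : sys M (Submodule.Quotient.mk a) ≤ (S.card : ℕ∞) := iInf₂_le z hz
  exact absurd (hs.trans_le h1) (not_lt.2 (by exact_mod_cast h2))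

variable (M) in
/-- The vertices that are joined to `c` by a chain of at most `r` edges. -/
def chainBall (c : ι) (r : ℕ) : Set ι :=
  {w | ∃ l : List (Simplex M 1), l.length ≤ r ∧ bd l = ind c + ind w}

theorem mem_chainBall_self (c : ι) (r : ℕ) : c ∈ chainBall M c r :=
  ⟨[], by simp, by rw [ind_add_self]; rfl⟩

theorem chainBall_mono (c : ι) {r r' : ℕ} (h : r ≤ r') : chainBall M c r ⊆ chainBall M c r' :=
  fun _ ⟨l, hl, hb⟩ => ⟨l, hl.trans h, hb⟩

open Classical in
/-- Two distinct vertices of a face span an edge. -/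
def edgeOf {s : Finset ι} (hs : s ∈ M.faces) {v w : ι} (hvw : v ≠ w) (hv : v ∈ s) (hw : w ∈ s) :
    Simplex M 1 :=
  ⟨{v, w}, (M.isRelLowerSet_faces hs).2 (by
    intro x hx
    rcases Finset.mem_insert.1 hx with rfl | hx
    · exact hv
    · rwa [Finset.mem_singleton.1 hx]) (by simp), Finset.card_pair hvw⟩

theorem left_mem_edgeOf {s : Finset ι} (hs : s ∈ M.faces) {v w : ι} (hvw : v ≠ w) (hv : v ∈ s)
    (hw : w ∈ s) : v ∈ (edgeOf hs hvw hv hw).1 := by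
  simp [edgeOf]

theorem right_mem_edgeOf {s : Finset ι} (hs : s ∈ M.faces) {v w : ι} (hvw : v ≠ w) (hv : v ∈ s)
    (hw : w ∈ s) : w ∈ (edgeOf hs hvw hv hw).1 := by
  simp [edgeOf]

theorem bd_edgeOf {s : Finset ι} (hs : s ∈ M.faces) {v w : ι} (hvw : v ≠ w) (hv : v ∈ s)
    (hw : w ∈ s) : bd [edgeOf hs hvw hv hw] = ind v + ind w :=
  bd_singleton _ hvw (left_mem_edgeOf ..) (right_mem_edgeOf ..)

theorem mem_chainBall_succ {s : Finset ι} (hs : s ∈ M.faces) {c v w : ι} {r : ℕ}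
    (hv : v ∈ s) (hw : w ∈ s) (h : v ∈ chainBall M c r) : w ∈ chainBall M c (r + 1) := by
  by_cases hvw : v = w
  · exact chainBall_mono c (Nat.le_succ r) (hvw ▸ h)
  · obtain ⟨l, hl, hb⟩ := h
    refine ⟨l ++ [edgeOf hs hvw hv hw], by simpa using hl, ?_⟩
    rw [bd_append, hb, bd_edgeOf]
    linear_combination ind_add_self v

/-- The two chains and the edge between `v` and `w` close up to a cycle; that edge is the extra `1`
in the length bound. -/
theorem segVal_eq_of_chains (a : Cocycle1 (realization M)) {s : Finset ι} (hs : s ∈ M.faces)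
    {c v w : ι} (hv : v ∈ s) (hw : w ∈ s) {l l' : List (Simplex M 1)}
    (hl : bd l = ind c + ind v) (hl' : bd l' = ind c + ind w)
    (hsys : ((l.length + l'.length + 1 : ℕ) : ℕ∞) < sys M (Submodule.Quotient.mk a)) :
    segVal a (vert v) (vert w) = chainVal a l + chainVal a l' := by
  by_cases hvw : v = w
  · subst hvw
    rw [segVal_self a (closedCell_subset hs (vert_mem_closedCell hv)), ← chainVal_append]
    refine (chainVal_eq_zero a _ ?_ (lt_of_le_of_lt ?_ hsys)).symm
    · rw [bd_append, hl, hl']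
      linear_combination ind_add_self c + ind_add_self v
    · rw [List.length_append]; exact_mod_cast Nat.le_succ _
  · have h := chainVal_eq_zero a (l ++ l' ++ [edgeOf hs hvw hv hw]) (by
      rw [bd_append, bd_append, hl, hl', bd_edgeOf]
      linear_combination ind_add_self c + ind_add_self v + ind_add_self w) (by
      simpa [add_assoc] using hsys)
    rw [chainVal_append, chainVal_append] at h
    have h1 : chainVal a [edgeOf hs hvw hv hw] = segVal a (vert v) (vert w) := by
      rw [← cocycle_edgeMap a (edgeOf hs hvw hv hw) hvw (left_mem_edgeOf ..)
        (right_mem_edgeOf ..)]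
      simp [chainVal]
    rw [h1] at h
    linear_combination h - CharTwo.add_self_eq_zero (chainVal a l + chainVal a l')

/-- A cocycle has a potential on each ball whose radius is small compared to the systole. -/
theorem exists_potential_chainBall (a : Cocycle1 (realization M)) (r : ℕ)
    (hr : ((2 * r + 1 : ℕ) : ℕ∞) < sys M (Submodule.Quotient.mk a)) (c : ι) :
    ∃ β : ι → ZMod 2, ∀ s ∈ M.faces, ∀ v ∈ s, ∀ w ∈ s, v ∈ chainBall M c r →
      w ∈ chainBall M c r → segVal a (vert v) (vert w) = β v + β w := by
  classical
  -- The potential is the value of a chosen chain from the centre. The default `0` is never tested,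
  -- since both vertices are assumed to be in the ball.
  refine ⟨fun v => if h : v ∈ chainBall M c r then chainVal a h.choose else 0, ?_⟩
  intro s hs v hv w hw hvc hwc
  simp only [hvc, hwc, dite_true]
  refine segVal_eq_of_chains a hs hv hw hvc.choose_spec.2 hwc.choose_spec.2
    (lt_of_le_of_lt ?_ hr)
  have h1 := hvc.choose_spec.1
  have h2 := hwc.choose_spec.1
  exact_mod_cast (by omega)

/-- With no detected cycle, chains of any length may be used, so one base vertex per connected
component gives a global potential. -/
theorem exists_potential_of_sys_eq_top (a : Cocycle1 (realization M))
    (h : sys M (Submodule.Quotient.mk a) = ⊤) :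
    ∃ β : ι → ZMod 2, ∀ s ∈ M.faces, ∀ v ∈ s, ∀ w ∈ s,
      segVal a (vert v) (vert w) = β v + β w := by
  let S : Setoid ι :=
    { r := fun v w => ∃ l : List (Simplex M 1), bd l = ind v + ind w
      iseqv :=
        { refl := fun v => ⟨[], by rw [ind_add_self]; rfl⟩
          symm := fun ⟨l, hl⟩ => ⟨l, by rw [hl, add_comm]⟩
          trans := fun {u v w} ⟨l, hl⟩ ⟨l', hl'⟩ => ⟨l ++ l', by
            rw [bd_append, hl, hl']
            linear_combination ind_add_self v⟩ } }
  have hrep : ∀ v : ι, ∃ l : List (Simplex M 1),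
      bd l = ind (Quotient.out (Quotient.mk S v)) + ind v := fun v => Quotient.mk_out (s := S) v
  choose l hl using hrep
  refine ⟨fun v => chainVal a (l v), fun s hs v hv w hw => ?_⟩
  have hvw : Quotient.mk S v = Quotient.mk S w := by
    apply Quotient.sound
    obtain ⟨m, -, hm⟩ := mem_chainBall_succ hs hv hw (mem_chainBall_self v 0)
    exact ⟨m, hm⟩
  refine segVal_eq_of_chains a hs hv hw (hl v) (by rw [hvw]; exact hl w) ?_
  rw [h]
  exact ENat.natCast_lt_top _

theorem sys_ne_top {α : H1 (realization M)} (hα : α ≠ 0) : sys M α ≠ ⊤ := by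
  intro h
  obtain ⟨a, rfl⟩ := Submodule.Quotient.mk_surjective _ α
  obtain ⟨β, hβ⟩ := exists_potential_of_sys_eq_top a h
  apply hα
  exact H1map_eq_zero_of_potential (ContinuousMap.id _) a M.faces subset_rfl
    (fun y => carrier_mem_faces y.2) (fun _ => β) (fun s hs v hv w hw => hβ s hs v hv w hw)
    (fun _ _ _ _ _ _ _ => rfl)

end Chains

/-! ### Ball growing and separating faces -/

section Separation

variable {ι P : Type*}

open Classical in
/-- The nonempty sets of `n` vertices that lie in two members of `S` with different labels. -/
def sepFaces (n : ℕ) (S : Finset (Finset ι)) (c : Finset ι → P) : Finset (Finset ι) :=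
  (S.biUnion fun s => s.powersetCard n).filter fun τ =>
    τ.Nonempty ∧ ∃ s ∈ S, ∃ t ∈ S, τ ⊆ s ∧ τ ⊆ t ∧ c s ≠ c t

theorem mem_sepFaces {n : ℕ} {S : Finset (Finset ι)} {c : Finset ι → P} {τ : Finset ι} :
    τ ∈ sepFaces n S c ↔
      τ.card = n ∧ τ.Nonempty ∧ ∃ s ∈ S, ∃ t ∈ S, τ ⊆ s ∧ τ ⊆ t ∧ c s ≠ c t := by
  classical
  simp only [sepFaces, Finset.mem_filter, Finset.mem_biUnion, Finset.mem_powersetCard]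
  constructor
  · rintro ⟨⟨s, -, -, h⟩, h'⟩
    exact ⟨h, h'⟩
  · rintro ⟨h, h', s, hs, t, ht, hτs, h''⟩
    exact ⟨⟨s, hs, hτs, h⟩, h', s, hs, t, ht, hτs, h''⟩

open Classical in
theorem card_biUnion_powersetCard_le {n : ℕ} {S : Finset (Finset ι)}
    (hS : ∀ s ∈ S, s.card = n + 1) :
    (S.biUnion fun s => s.powersetCard n).card ≤ (n + 1) * S.card := by
  rw [mul_comm]
  refine Finset.card_biUnion_le_card_mul _ _ _ fun s hs => ?_
  rw [Finset.card_powersetCard, hS s hs, Nat.choose_succ_self_right]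

theorem card_sepFaces_le {n : ℕ} {S : Finset (Finset ι)} (hS : ∀ s ∈ S, s.card = n + 1)
    (c : Finset ι → P) : (sepFaces n S c).card ≤ (n + 1) * S.card := by
  classical
  exact (Finset.card_filter_le _ _).trans (card_biUnion_powersetCard_le hS)

/-- Otherwise `f` would be multiplied by more than `1 + δ` at each of `R` steps, starting from at
least `1`, and exceed `N`. -/
theorem exists_slow_growth (f : ℕ → ℕ) (N R : ℕ) (δ : ℝ) (hδ : 0 ≤ δ) (h1 : 1 ≤ f 1)
    (hN : ∀ r, f r ≤ N) (hR : (N : ℝ) < (1 + δ) ^ R) :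
    ∃ r, 1 ≤ r ∧ r ≤ R ∧ (f (r + 1) : ℝ) ≤ (1 + δ) * f r := by
  by_contra! h
  have key : ∀ m ≤ R, (1 + δ) ^ m ≤ (f (m + 1) : ℝ) := by
    intro m
    induction m with
    | zero => intro _; simpa using h1
    | succ m ih =>
      intro hm
      calc (1 + δ) ^ (m + 1) = (1 + δ) * (1 + δ) ^ m := by ring
        _ ≤ (1 + δ) * f (m + 1) := by gcongr; exact ih (by omega)
        _ ≤ f (m + 1 + 1) := (h (m + 1) (by omega) hm).le
  have h2 : (f (R + 1) : ℝ) ≤ N := by exact_mod_cast hN _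
  linarith [key R le_rfl]

/-- Ball growing: a finite family of `n`-simplices can be divided into parts of radius at most `R`
such that few `(n-1)`-simplices lie in two different parts. -/
theorem exists_centers {n : ℕ} (D : ι → ℕ → Set ι) (R : ℕ) (δ : ℝ) (hδ : 0 ≤ δ) (v₀ : ι)
    (hmono : ∀ v r r', r ≤ r' → D v r ⊆ D v r') (S : Finset (Finset ι))
    (hS : ∀ s ∈ S, s.card = n + 1) (hone : ∀ s ∈ S, ∀ v ∈ s, (s : Set ι) ⊆ D v 1)
    (hsucc : ∀ v r, ∀ t ∈ S, ∀ x ∈ t, x ∈ D v r → (t : Set ι) ⊆ D v (r + 1))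
    (hR : (S.card : ℝ) < (1 + δ) ^ R) :
    ∃ c : Finset ι → ι, (∀ s ∈ S, (s : Set ι) ⊆ D (c s) R) ∧
      ((sepFaces n S c).card : ℝ) ≤ (n + 1) * δ * S.card := by
  classical
  induction S using Finset.strongInduction with
  | H S ih =>
    rcases S.eq_empty_or_nonempty with rfl | ⟨s₀, hs₀⟩
    · exact ⟨fun _ => v₀, by simp, by simp [sepFaces]⟩
    obtain ⟨v, hv⟩ : s₀.Nonempty := Finset.card_pos.1 (by rw [hS s₀ hs₀]; omega)
    -- The balls `D` stay fixed throughout the induction; only the family of simplices not yet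
    -- assigned shrinks.
    let A : ℕ → Finset (Finset ι) := fun r => S.filter fun s => (s : Set ι) ⊆ D v r
    have hAS : ∀ r, A r ⊆ S := fun r => Finset.filter_subset _ _
    have hA1 : s₀ ∈ A 1 := Finset.mem_filter.2 ⟨hs₀, hone s₀ hs₀ v hv⟩
    have hAmono : ∀ {r r'}, r ≤ r' → A r ⊆ A r' := fun h s hs =>
      Finset.mem_filter.2 ⟨(Finset.mem_filter.1 hs).1,
        (Finset.mem_filter.1 hs).2.trans (hmono v _ _ h)⟩
    obtain ⟨r, hr1, hrR, hr⟩ := exists_slow_growth (fun r => (A r).card) S.card R δ hδ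
      (Finset.card_pos.2 ⟨s₀, hA1⟩) (fun r => Finset.card_le_card (hAS r)) hR
    have hs₀r : s₀ ∈ A r := hAmono hr1 hA1
    have hss : S \ A r ⊂ S := Finset.sdiff_ssubset (hAS r) ⟨s₀, hs₀r⟩
    have hsub : ∀ s ∈ S \ A r, s ∈ S := fun s hs => hss.subset hs
    obtain ⟨c', hc', hcard⟩ := ih (S \ A r) hss (fun s hs => hS s (hsub s hs))
      (fun s hs => hone s (hsub s hs)) (fun v r t ht => hsucc v r t (hsub t ht))
      (lt_of_le_of_lt (by exact_mod_cast Finset.card_le_card hss.subset) hR)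
    refine ⟨fun s => if s ∈ A r then v else c' s, fun s hs => ?_, ?_⟩
    · by_cases h : s ∈ A r
      · simpa only [h, if_true] using (Finset.mem_filter.1 h).2.trans (hmono v _ _ hrR)
      · simpa only [h, if_false] using hc' s (Finset.mem_sdiff.2 ⟨hs, h⟩)
    have hcover : sepFaces n S (fun s => if s ∈ A r then v else c' s) ⊆
        sepFaces n (S \ A r) c' ∪
          (A (r + 1) \ A r).biUnion fun s => s.powersetCard n := by
      intro τ hτ
      obtain ⟨hτn, ⟨x, hx⟩, s, hs, t, ht, hτs, hτt, hst⟩ := mem_sepFaces.1 hτ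
      -- A simplex outside the cluster that shares a vertex with it lies in the ball of radius `r +
      -- 1`, hence in the boundary layer. The shared vertex `x` exists because `τ` is nonempty.
      have layer : ∀ s ∈ A r, ∀ t ∈ S, t ∉ A r → τ ⊆ s → τ ⊆ t →
          τ ∈ (A (r + 1) \ A r).biUnion fun s => s.powersetCard n := by
        intro s hs t ht htr hτs hτt
        refine Finset.mem_biUnion.2 ⟨t, Finset.mem_sdiff.2 ⟨Finset.mem_filter.2 ⟨ht, ?_⟩, htr⟩,
          Finset.mem_powersetCard.2 ⟨hτt, hτn⟩⟩
        exact hsucc v r t ht x (hτt hx) ((Finset.mem_filter.1 hs).2 (hτs hx))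
      rw [Finset.mem_union]
      by_cases h1 : s ∈ A r <;> by_cases h2 : t ∈ A r
      · simp [h1, h2] at hst
      · exact Or.inr (layer s h1 t ht h2 hτs hτt)
      · exact Or.inr (layer t h2 s hs h1 hτt hτs)
      · simp only [h1, h2, if_false] at hst
        exact Or.inl (mem_sepFaces.2 ⟨hτn, ⟨x, hx⟩, s, Finset.mem_sdiff.2 ⟨hs, h1⟩, t,
          Finset.mem_sdiff.2 ⟨ht, h2⟩, hτs, hτt, hst⟩)
    have h1 := (Finset.card_le_card hcover).trans (Finset.card_union_le _ _)
    have h2 := card_biUnion_powersetCard_le (n := n) (S := A (r + 1) \ A r)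
      fun s hs => hS s (hAS _ (Finset.mem_sdiff.1 hs).1)
    have h3 : ((A (r + 1) \ A r).card : ℝ) = (A (r + 1)).card - (A r).card := by
      rw [eq_sub_iff_add_eq]
      exact_mod_cast Finset.card_sdiff_add_card_eq_card (hAmono (Nat.le_succ r))
    have h4 : ((S \ A r).card : ℝ) = S.card - (A r).card := by
      rw [eq_sub_iff_add_eq]
      exact_mod_cast Finset.card_sdiff_add_card_eq_card (hAS r)
    have h5 : ((sepFaces n S (fun s => if s ∈ A r then v else c' s)).card : ℝ) ≤
        (sepFaces n (S \ A r) c').card + (n + 1) * (A (r + 1) \ A r).card := by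
      exact_mod_cast h1.trans (Nat.add_le_add_left h2 _)
    -- The cost of the layer is charged to the removed cluster; since clusters are disjoint, the
    -- charges add up to at most `(n + 1) * δ * S.card`.
    have h6 : ((n : ℝ) + 1) * (A (r + 1) \ A r).card ≤ (n + 1) * (δ * (A r).card) := by
      gcongr
      rw [h3]
      linarith
    rw [h4] at hcard
    linarith

end Separation

/-! ### Cutting subcomplexes from labelled simplices -/

section Cuts

variable {ι P : Type*} {M : PreAbstractSimplicialComplex ι}

/-- The `(n-2)`-skeleton of `M` together with the `(n-1)`-simplices between `n`-simplices with
different labels. -/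
def cutComplex (M : PreAbstractSimplicialComplex ι) (n : ℕ) (S : Finset (Finset ι))
    (c : Finset ι → P) : PreAbstractSimplicialComplex ι where
  faces := {s | s ∈ M.faces ∧ (s.card < n ∨ s ∈ sepFaces n S c)}
  isRelLowerSet_faces := by
    rintro s ⟨hs, h⟩
    refine ⟨(M.isRelLowerSet_faces hs).1, fun t hts ht => ?_⟩
    refine ⟨(M.isRelLowerSet_faces hs).2 hts ht, ?_⟩
    rcases eq_or_ssubset_of_subset hts with rfl | hlt
    · exact h
    · have h1 := Finset.card_lt_card hlt
      rcases h with h | h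
      · exact Or.inl (h1.trans h)
      · exact Or.inl (h1.trans_eq (mem_sepFaces.1 h).1)

/-- A cocycle has a potential on each simplex. -/
theorem exists_potential_face (a : Cocycle1 (realization M)) (s : Finset ι) :
    ∃ β : ι → ZMod 2, s ∈ M.faces → ∀ v ∈ s, ∀ w ∈ s,
      segVal a (vert v) (vert w) = β v + β w := by
  by_cases hs : s ∈ M.faces
  · obtain ⟨x, hx⟩ := (M.isRelLowerSet_faces hs).1
    exact ⟨fun v => segVal a (vert x) (vert v), fun _ v hv w hw =>
      (segVal_triangle a (convex_closedCell s) (closedCell_subset hs) (vert_mem_closedCell hx)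
        (vert_mem_closedCell hv) (vert_mem_closedCell hw)).symm⟩
  · exact ⟨0, fun h => absurd h hs⟩

/-- Off the cut complex only `n`-simplices and unseparated `(n-1)`-simplices remain. All
`n`-simplices around one of the latter have the same label, so it inherits their potential without
ambiguity. -/
theorem cut_le_card_sepFaces {n : ℕ} (hdim : ∀ s ∈ M.faces, s.card ≤ n + 1)
    {S : Finset (Finset ι)} (hS : ∀ s, s ∈ S ↔ s ∈ M.faces ∧ s.card = n + 1)
    (a : Cocycle1 (realization M)) (c : Finset ι → P) (β : P → ι → ZMod 2)
    (hβ : ∀ s ∈ S, ∀ v ∈ s, ∀ w ∈ s,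
      segVal a (vert v) (vert w) = β (c s) v + β (c s) w) :
    cut M n (Submodule.Quotient.mk a) ≤ (sepFaces n S c).card := by
  classical
  set L := cutComplex M n S c with hL
  have hcuts : Cuts M n (Submodule.Quotient.mk a) L := by
    refine ⟨fun s hs => hs.1, ?_, ?_⟩
    · rintro s ⟨-, h | h⟩
      · exact h.le
      · exact (mem_sepFaces.1 h).1.le
    choose b hb using exists_potential_face a
    refine H1map_eq_zero_of_potential _ a {s | s ∈ M.faces ∧ s ∉ L.faces} (fun s hs => hs.1)
      (fun y => ⟨carrier_mem_faces y.2.1, fun h => y.2.2 (closedCell_subset h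
        (mem_closedCell_carrier y.2.1))⟩)
      -- An `(n-1)`-simplex in no `n`-simplex has no label; it uses its own potential `b s`, which
      -- need not match anything.
      (fun s v => if h : ∃ t ∈ S, s ⊆ t then β (c h.choose) v else b s v) ?_ ?_
    · rintro s ⟨hs, -⟩ v hv w hw
      split_ifs with h
      · exact hβ _ h.choose_spec.1 v (h.choose_spec.2 hv) w (h.choose_spec.2 hw)
      · exact hb s hs v hv w hw
    · rintro s ⟨hs, hsL⟩ t ⟨ht, htL⟩ hst v hv
      rcases eq_or_ssubset_of_subset hst with rfl | hlt
      · rfl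
      have h1 := Finset.card_lt_card hlt
      have h2 := hdim t ht
      have h3 : n ≤ s.card := not_lt.1 fun h => hsL ⟨hs, Or.inl h⟩
      have htS : t ∈ S := (hS t).2 ⟨ht, by omega⟩
      have hsE : ∃ t ∈ S, s ⊆ t := ⟨t, htS, hst⟩
      have htE : ∃ t' ∈ S, t ⊆ t' := ⟨t, htS, subset_rfl⟩
      rw [dif_pos hsE, dif_pos htE]
      -- The only `n`-simplex containing `t` is `t` itself.
      have h4 : t = htE.choose := Finset.eq_of_subset_of_card_le htE.choose_spec.2 (by
        rw [((hS _).1 htE.choose_spec.1).2, ((hS _).1 htS).2])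
      rw [← h4]
      congr 1
      by_contra hne
      exact hsL ⟨hs, Or.inr (mem_sepFaces.2 ⟨by omega, ⟨v, hv⟩, _, hsE.choose_spec.1, t, htS,
        hsE.choose_spec.2, hst, fun h => hne (by rw [h])⟩)⟩
  refine (iInf₂_le L hcuts).trans ?_
  rw [← Set.encard_coe_eq_coe_finsetCard]
  refine Set.encard_le_encard ?_
  rintro s ⟨⟨-, h | h⟩, hn⟩
  · omega
  · exact h

/-- Every `n`-simplex is its own cluster. This gives finiteness of the cut and settles the case of
bounded systole. -/
theorem cut_le_mul_vol {n : ℕ} (hdim : ∀ s ∈ M.faces, s.card ≤ n + 1)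
    {S : Finset (Finset ι)} (hS : ∀ s, s ∈ S ↔ s ∈ M.faces ∧ s.card = n + 1)
    (a : Cocycle1 (realization M)) :
    cut M n (Submodule.Quotient.mk a) ≤ ((n + 1) * S.card : ℕ) := by
  choose b hb using exists_potential_face a
  exact (cut_le_card_sepFaces hdim hS a id b fun s hs => hb s ((hS s).1 hs).1).trans
    (by exact_mod_cast card_sepFaces_le (fun s hs => ((hS s).1 hs).2) id)

theorem cut_le_of_lt_sys {n : ℕ} (hdim : ∀ s ∈ M.faces, s.card ≤ n + 1)
    {S : Finset (Finset ι)} (hS : ∀ s, s ∈ S ↔ s ∈ M.faces ∧ s.card = n + 1)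
    (hSne : S.Nonempty) (a : Cocycle1 (realization M)) (R : ℕ)
    (hsys : ((2 * R + 1 : ℕ) : ℕ∞) < sys M (Submodule.Quotient.mk a)) (δ : ℝ) (hδ : 0 ≤ δ)
    (hR : (S.card : ℝ) < (1 + δ) ^ R) :
    ((cut M n (Submodule.Quotient.mk a)).toNat : ℝ) ≤ (n + 1) * δ * S.card := by
  have hSM : ∀ s ∈ S, s ∈ M.faces := fun s hs => ((hS s).1 hs).1
  obtain ⟨s₀, hs₀⟩ := hSne
  obtain ⟨v₀, -⟩ := (M.isRelLowerSet_faces (hSM s₀ hs₀)).1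
  obtain ⟨c, hc, hcard⟩ := exists_centers (n := n) (chainBall M) R δ hδ v₀
    (fun v r r' h => chainBall_mono v h) S (fun s hs => ((hS s).1 hs).2)
    (fun s hs v hv w hw => mem_chainBall_succ (hSM s hs) hv hw (mem_chainBall_self v 0))
    (fun v r t ht x hx hxv w hw => mem_chainBall_succ (hSM t ht) hx hw hxv) hR
  choose β hβ using exists_potential_chainBall a R hsys
  have h := cut_le_card_sepFaces hdim hS a c β fun s hs v hv w hw =>
    hβ (c s) s (hSM s hs) v hv w hw (hc s hs hv) (hc s hs hw)
  have h1 := ENat.toNat_le_of_le_natCast h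
  exact le_trans (by exact_mod_cast h1) hcard

end Cuts

end SystolicCut

end

theorem theorem2 (n : ℕ) (ε : ℝ) (hε : 0 < ε) :
    ∃ c : ℝ, ∀ (ι : Type*) (M : PreAbstractSimplicialComplex ι), M.faces.Finite →
      SystolicCut.HasDimension M n →
      ∀ α : SystolicCut.H1 (SystolicCut.realization M), α ≠ 0 →
        SystolicCut.sys M α ≠ ⊤ ∧ SystolicCut.cut M n α ≠ ⊤ ∧
        ((SystolicCut.sys M α).toNat : ℝ) * ((SystolicCut.cut M n α).toNat : ℝ) ≤
          c * (SystolicCut.vol M n : ℝ) ^ (1 + ε) := by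
  -- With `k ≥ 1/ε`, the `k`-th power of `V^ε` is at least `V`.
  obtain ⟨k, hk⟩ := exists_nat_ge ε⁻¹
  have hkε : 1 ≤ ε * k := by
    rw [mul_comm]
    exact (inv_le_iff_one_le_mul₀ hε).1 hk
  have hk0 : 0 < k := by
    rcases Nat.eq_zero_or_pos k with rfl | h
    · norm_num at hkε
    · exact h
  refine ⟨(4 * k + 2) * (n + 1), fun ι M hM hdim α hα => ?_⟩
  have hsys := SystolicCut.sys_ne_top hα
  obtain ⟨a, rfl⟩ := Submodule.Quotient.mk_surjective _ α
  have hfin : {s | s ∈ M.faces ∧ s.card = n + 1}.Finite := hM.subset fun s hs => hs.1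
  set S := hfin.toFinset with hSdef
  have hS : ∀ s, s ∈ S ↔ s ∈ M.faces ∧ s.card = n + 1 := fun s => by simp [hSdef]
  have hSne : S.Nonempty := by
    obtain ⟨s, hs⟩ := hdim.1
    exact ⟨s, (hS s).2 hs⟩
  have hvol : SystolicCut.vol M n = S.card := Set.ncard_eq_toFinset_card _ hfin
  have htriv := SystolicCut.cut_le_mul_vol hdim.2 hS a
  refine ⟨hsys, ne_top_of_le_ne_top (ENat.natCast_ne_top _) htriv, ?_⟩
  rw [hvol]
  have hN : (1 : ℝ) ≤ S.card := by exact_mod_cast hSne.card_pos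
  have hpow : (S.card : ℝ) ^ (1 + ε) = S.card * (S.card : ℝ) ^ ε := by
    rw [Real.rpow_add (by linarith), Real.rpow_one]
  have hNε : (1 : ℝ) ≤ (S.card : ℝ) ^ ε := Real.one_le_rpow hN hε.le
  have hLcoe := ENat.natCast_toNat hsys
  rw [hpow]
  set l := (SystolicCut.sys M (Submodule.Quotient.mk a)).toNat with hl
  set m := (SystolicCut.cut M n (Submodule.Quotient.mk a)).toNat with hm
  -- When positive, the quotient is the largest `q` for which the radius `R = q * k` satisfies `2 *
  -- R + 1 < l`. When it is zero, `l` is bounded and the trivial cut suffices.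
  rcases Nat.eq_zero_or_pos ((l - 2) / (2 * k)) with hq | hq
  · have hl' : l ≤ 4 * k + 2 := by
      have := (Nat.div_eq_zero_iff_lt (by omega)).1 hq
      omega
    have hm' : m ≤ (n + 1) * S.card := ENat.toNat_le_of_le_natCast htriv
    have hl'' : (l : ℝ) ≤ 4 * k + 2 := by exact_mod_cast hl'
    have hm'' : (m : ℝ) ≤ (n + 1) * S.card := by exact_mod_cast hm'
    calc (l : ℝ) * m ≤ (4 * k + 2) * ((n + 1) * S.card) := by gcongr
      _ = (4 * k + 2) * (n + 1) * (S.card * 1) := by ring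
      _ ≤ _ := by gcongr
  · set q := (l - 2) / (2 * k) with hqdef
    have h1 : q * (2 * k) ≤ l - 2 := Nat.div_mul_le_self _ _
    have h2 : l - 2 < (q + 1) * (2 * k) := Nat.lt_mul_of_div_lt (Nat.lt_succ_self _) (by omega)
    have h2k : 2 * k ≤ q * (2 * k) := Nat.le_mul_of_pos_left _ hq
    -- From `l < 2k(q + 1) + 2` and `q ≥ 1`.
    have hl' : l ≤ (4 * k + 2) * q := by
      have e1 : (q + 1) * (2 * k) = q * (2 * k) + 2 * k := by ring
      have e2 : (4 * k + 2) * q = 2 * (q * (2 * k)) + 2 * q := by ring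
      omega
    have hq' : (1 : ℝ) ≤ q := by exact_mod_cast hq
    -- The choice `δ = V^ε / q` makes Bernoulli's inequality give `(1 + δ)^q ≥ 1 + V^ε`, whose
    -- `k`-th power exceeds `V`. The factor `1 / q` in `δ` then cancels the `q` in the bound for
    -- `l`.
    have hbound := SystolicCut.cut_le_of_lt_sys hdim.2 hS hSne a (q * k) (by
      rw [← hLcoe]
      have : 2 * (q * k) = q * (2 * k) := by ring
      exact_mod_cast (by omega : 2 * (q * k) + 1 < l)) ((S.card : ℝ) ^ ε / q) (by positivity) (by
      calc (S.card : ℝ) = (S.card : ℝ) ^ (1 : ℝ) := (Real.rpow_one _).symm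
        _ ≤ (S.card : ℝ) ^ (ε * k) := Real.rpow_le_rpow_of_exponent_le hN hkε
        _ = ((S.card : ℝ) ^ ε) ^ k := by rw [Real.rpow_mul (by linarith), Real.rpow_natCast]
        _ < (1 + (S.card : ℝ) ^ ε) ^ k := by
          exact pow_lt_pow_left₀ (by linarith) (by linarith) hk0.ne'
        _ = (1 + q * ((S.card : ℝ) ^ ε / q)) ^ k := by
          rw [mul_div_cancel₀ _ (by linarith)]
        _ ≤ ((1 + (S.card : ℝ) ^ ε / q) ^ q) ^ k := by
          refine pow_le_pow_left₀ (by positivity) (one_add_mul_le_pow ?_ q) k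
          have : (0 : ℝ) ≤ (S.card : ℝ) ^ ε / q := by positivity
          linarith
        _ = _ := by rw [pow_mul])
    have hl'' : (l : ℝ) ≤ (4 * k + 2) * q := by exact_mod_cast hl'
    calc (l : ℝ) * m ≤ ((4 * k + 2) * q) * ((n + 1) * ((S.card : ℝ) ^ ε / q) * S.card) := by
          gcongr
      _ = _ := by field_simp
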